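/- For a positive integer $k$ let $[k]=\{1,2,\dots,k\}$, and let $[k]^n$ be the set of words of length $n$ with letters in $[k]$. A word $w=w_1\cdots w_n$ \emph{contains} the pattern $v=v_1\cdots v_r$ (a word of positive integers) if there are $1\le t_1<\cdots<t_r\le n$ such that, for all $1\le i,j\le r$, $w_{t_i}\le w_{t_j}$ if and only if $v_i\le v_j$; otherwise $w$ \emph{avoids} $v$. Let $[k]^n(v)$ denote the set of words in $[k]^n$ that avoid $v$, and let $p_\ell=12\cdots(\ell+1)$. For real sequences write $a_n\simeq b_n$ if $\lim_{n\to\infty}a_n/b_n=1$. \textbf{Theorem (Regev).} For all integers $k\ge \ell\ge 1$, $$|[k]^n(p_\ell)|\simeq C_{\ell,k}\,n^{\ell(k-\ell)}\,\ell^n\qquad(n\to\infty),$$ where $$C_{\ell,k}^{-1}=\ell^{\ell(k-\ell)}\prod_{i=1}^{\ell}\prod_{j=1}^{k-\ell}(i+j-1).$$ -/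

import Mathlib

namespace PatternAvoidance

/-- The word `w` of length `s` contains the pattern `v` of length `r`: there are positions
`t 0 < t 1 < ⋯ < t (r - 1)` of `w` such that `w (t i) ≤ w (t j)` if and only if `v i ≤ v j`,
for all positions `i, j` of `v`. -/
def Contains {α β : Type*} [LE α] [LE β] {s r : ℕ} (w : Fin s → α) (v : Fin r → β) : Prop :=
  ∃ t : Fin r → Fin s, StrictMono t ∧ ∀ i j : Fin r, w (t i) ≤ w (t j) ↔ v i ≤ v j

/-- The word `w` avoids the pattern `v`. -/
def Avoids {α β : Type*} [LE α] [LE β] {s r : ℕ} (w : Fin s → α) (v : Fin r → β) : Prop :=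
  ¬ Contains w v

/-- The set of words of length `n` over a totally ordered alphabet with `k` letters (modelled as
`Fin k`, with letters `0 < 1 < ⋯ < k - 1`) that avoid the pattern `v`. -/
def avoidingWords (k n : ℕ) {β : Type*} [LE β] {r : ℕ} (v : Fin r → β) : Set (Fin n → Fin k) :=
  {w | Avoids w v}

/-- The increasing pattern `12⋯(ℓ+1)`, as a word of length `ℓ + 1` whose letters are positive
integers. -/
def increasingPattern (ℓ : ℕ) : Fin (ℓ + 1) → ℕ := fun i => (i : ℕ) + 1

/-- The constant `C_{ℓ,k}`, given by
`C_{ℓ,k}⁻¹ = ℓ^{ℓ(k-ℓ)} ∏_{i=1}^{ℓ} ∏_{j=1}^{k-ℓ} (i + j - 1)`; it is used for `ℓ ≤ k` only. -/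
noncomputable def regevConstant (ℓ k : ℕ) : ℝ :=
  ((ℓ : ℝ) ^ (ℓ * (k - ℓ)) *
    ∏ i ∈ Finset.Icc 1 ℓ, ∏ j ∈ Finset.Icc 1 (k - ℓ), ((i : ℝ) + (j : ℝ) - 1))⁻¹

/-- `a n ≃ b n` as `n → ∞`: the ratio `a n / b n` tends to `1`. -/
def AsympEq (a b : ℕ → ℝ) : Prop :=
  Filter.Tendsto (fun n => a n / b n) Filter.atTop (nhds 1)

end PatternAvoidance

/-! Patience sorting turns the words into walks. The state is a strictly increasing `a` of length
`ℓ`; reading `x` replaces the first `a i ≥ x` by `x`, and the pattern appears when there is none.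
The start is the top `ℓ` letters, a harmless prefix (`hasLongExtension_initial_iff`). Exactly `ℓ`
letters fix a state; every other accepted letter lowers its sum. Choosing when these moves occur
gives the count `∑ m, D m * n.choose m * ℓ ^ (n - m)`, where `D m` is `descentCount m` at the start.
The sum can drop by at most `N = ℓ * (k - ℓ)`, so `D N * n ^ N / N! * ℓ ^ (n - N)` dominates. The
`N` moves must then be unit steps. They remove boxes one at a time from an `ℓ × (k - ℓ)` rectangle,
so `D N` counts standard Young tableaux; a determinant gives `N! / ∏ (i + j - 1)`. -/

namespace PatternAvoidance

open Finset Function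

/-! ### The automaton of patience sorting -/

section Automaton

variable {ℓ : ℕ}

/-- Appending the word `u` to the strictly increasing word `a` of length `ℓ` creates a strictly
increasing subsequence of length `ℓ + 1`. -/
def HasLongExtension (a : Fin ℓ → ℕ) (u : List ℕ) : Prop :=
  ∃ y s, (y :: s).Sublist u ∧ (y :: s).Pairwise (· < ·) ∧
    ℓ < #{i | a i < y} + (y :: s).length

/-- The position `i` of the state `a` is the one replaced when the letter `x` is read. -/
def IsBumped (a : Fin ℓ → ℕ) (x : ℕ) (i : Fin ℓ) : Prop :=
  x ≤ a i ∧ ∀ j < i, a j < x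

instance (a : Fin ℓ → ℕ) (x : ℕ) (i : Fin ℓ) : Decidable (IsBumped a x i) :=
  inferInstanceAs (Decidable (_ ∧ _))

theorem IsBumped.eq {a : Fin ℓ → ℕ} {x : ℕ} {i j : Fin ℓ} (hi : IsBumped a x i)
    (hj : IsBumped a x j) : i = j := by
  rcases lt_trichotomy i j with h | h | h
  · exact absurd (hj.2 i h) (not_lt.2 hi.1)
  · exact h
  · exact absurd (hi.2 j h) (not_lt.2 hj.1)

theorem exists_isBumped {a : Fin ℓ → ℕ} {x : ℕ} (h : ∃ i, x ≤ a i) : ∃ i, IsBumped a x i := by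
  have hne : ({i | x ≤ a i} : Finset (Fin ℓ)).Nonempty := by
    obtain ⟨i, hi⟩ := h
    exact ⟨i, by simpa using hi⟩
  refine ⟨_, by simpa using min'_mem _ hne, fun j hj => ?_⟩
  by_contra hx
  exact absurd (min'_le _ j (by simpa using hx)) (not_le.2 hj)

theorem IsBumped.strictMono_update {a : Fin ℓ → ℕ} (ha : StrictMono a) {x : ℕ} {i : Fin ℓ}
    (hi : IsBumped a x i) : StrictMono (update a i x) := by
  intro p q hpq
  have h := ha hpq
  by_cases hp : p = i
  · subst hp
    rw [update_self, update_of_ne hpq.ne']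
    exact hi.1.trans_lt h
  · by_cases hq : q = i
    · subst hq
      rw [update_self, update_of_ne hp]
      exact hi.2 p hpq
    · rwa [update_of_ne hp, update_of_ne hq]

theorem IsBumped.update_le {a : Fin ℓ → ℕ} {x : ℕ} {i : Fin ℓ} (hi : IsBumped a x i)
    (j : Fin ℓ) : update a i x j ≤ a j := by
  rcases eq_or_ne j i with rfl | h
  · simpa using hi.1
  · simp [h]

theorem card_filter_lt_of_isBumped {a : Fin ℓ → ℕ} (ha : StrictMono a) {x : ℕ} {i : Fin ℓ}
    (hi : IsBumped a x i) : #{j | a j < x} = (i : ℕ) := by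
  rw [← Fin.card_Iio i]
  congr 1
  ext j
  simp only [mem_filter, mem_univ, true_and, mem_Iio]
  exact ⟨fun h => ha.lt_iff_lt.1 (h.trans_le hi.1), hi.2 j⟩

theorem not_hasLongExtension_nil (a : Fin ℓ → ℕ) : ¬ HasLongExtension a [] := by
  rintro ⟨y, s, h, -⟩
  simp at h

theorem hasLongExtension_cons_of_forall_lt {a : Fin ℓ → ℕ} {x : ℕ} (h : ∀ i, a i < x)
    (u : List ℕ) : HasLongExtension a (x :: u) :=
  ⟨x, [], by simp, by simp, by simp [h]⟩

/-- A subsequence starting with `x` may drop it, since the updated state has one more entry below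
the next letter; conversely `x` can be put back. -/
theorem hasLongExtension_cons_iff {a : Fin ℓ → ℕ} (ha : StrictMono a) {x : ℕ} {i : Fin ℓ}
    (hi : IsBumped a x i) (u : List ℕ) :
    HasLongExtension a (x :: u) ↔ HasLongExtension (update a i x) u := by
  have hcard := card_filter_lt_of_isBumped ha hi
  constructor
  · rintro ⟨y, s, hsub, hs, hlen⟩
    rcases List.sublist_cons_iff.1 hsub with h | ⟨r, hr, hru⟩
    · refine ⟨y, s, h, hs, hlen.trans_le (Nat.add_le_add_right (card_le_card ?_) _)⟩
      exact monotone_filter_right _ fun j _ hj => (hi.update_le j).trans_lt hj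
    · obtain ⟨rfl, rfl⟩ := List.cons.inj hr
      rw [hcard] at hlen
      rcases s with _ | ⟨z, s⟩
      · simp only [List.length_singleton] at hlen
        have := i.isLt
        omega
      · have hz : y < z := (List.pairwise_cons.1 hs).1 z (by simp)
        refine ⟨z, s, hru, (List.pairwise_cons.1 hs).2, ?_⟩
        have : (i : ℕ) + 1 ≤ #{j | update a i y j < z} := by
          rw [← Fin.card_Iic i]
          refine card_le_card fun j hj => ?_
          simp only [mem_filter, mem_univ, true_and]
          rcases (mem_Iic.1 hj).eq_or_lt with rfl | hj
          · simpa using hz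
          · rw [update_of_ne hj.ne]
            exact (hi.2 j hj).trans hz
        simp only [List.length_cons] at hlen ⊢
        omega
  · rintro ⟨y, s, hsub, hs, hlen⟩
    -- The only case in which the update makes position `i` count: prepending `x` makes up for the
    -- loss.
    by_cases hy : x < y ∧ y ≤ a i
    · refine ⟨x, y :: s, hsub.cons_cons x, ?_, ?_⟩
      · refine List.pairwise_cons.2 ⟨fun z hz => ?_, hs⟩
        rcases List.mem_cons.1 hz with rfl | hz
        · exact hy.1
        · exact hy.1.trans ((List.pairwise_cons.1 hs).1 z hz)
      · have : #{j | update a i x j < y} ≤ (i : ℕ) + 1 := by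
          rw [← Fin.card_Iic i]
          refine card_le_card fun j hj => ?_
          simp only [mem_filter, mem_univ, true_and] at hj
          rw [mem_Iic]
          by_contra hij
          rw [not_le] at hij
          rw [update_of_ne hij.ne'] at hj
          exact absurd (ha hij) (by omega)
        rw [hcard]
        simp only [List.length_cons] at hlen ⊢
        omega
    · refine ⟨y, s, hsub.cons x, hs, hlen.trans_le (Nat.add_le_add_right (card_le_card ?_) _)⟩
      refine monotone_filter_right _ fun j _ hj => ?_
      rcases eq_or_ne j i with rfl | h
      · rw [update_self] at hj
        omega
      · rwa [update_of_ne h] at hj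

/-- The number of words of length `n` over `k` letters that do not extend the state `a` to a
strictly increasing subsequence of length `ℓ + 1`. -/
noncomputable def acceptCount (k n : ℕ) (a : Fin ℓ → ℕ) : ℕ :=
  Nat.card {w : Fin n → Fin k // ¬ HasLongExtension a (List.ofFn fun i => (w i : ℕ))}

theorem acceptCount_zero (k : ℕ) (a : Fin ℓ → ℕ) : acceptCount k 0 a = 1 := by
  simp [acceptCount, not_hasLongExtension_nil]

theorem acceptCount_succ_eq_sum_letters (k n : ℕ) (a : Fin ℓ → ℕ) :
    acceptCount k (n + 1) a = ∑ x : Fin k, Nat.card {w : Fin n → Fin k //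
      ¬ HasLongExtension a ((x : ℕ) :: List.ofFn fun i => (w i : ℕ))} := by
  rw [acceptCount, ← Nat.card_sigma]
  refine Nat.card_congr (Equiv.trans ?_ (Equiv.subtypeProdEquivSigmaSubtype
    fun (x : Fin k) (w : Fin n → Fin k) =>
      ¬ HasLongExtension a ((x : ℕ) :: List.ofFn fun i => (w i : ℕ))))
  refine ((Fin.consEquiv fun _ => Fin k).subtypeEquiv fun p => ?_).symm
  simp [Fin.consEquiv, List.ofFn_succ]

theorem card_words_with_first_letter {a : Fin ℓ → ℕ} (ha : StrictMono a) (k n x : ℕ) :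
    Nat.card {w : Fin n → Fin k //
      ¬ HasLongExtension a (x :: List.ofFn fun i => (w i : ℕ))} =
      ∑ i, if IsBumped a x i then acceptCount k n (update a i x) else 0 := by
  by_cases h : ∃ i, x ≤ a i
  · obtain ⟨i, hi⟩ := exists_isBumped h
    rw [Finset.sum_eq_single i (fun j _ hj => if_neg fun h => hj (h.eq hi)) (by simp), if_pos hi,
      acceptCount]
    simp_rw [hasLongExtension_cons_iff ha hi]
  · push Not at h
    rw [Finset.sum_eq_zero fun i _ => if_neg fun hi => absurd hi.1 (not_le.2 (h i))]
    simp [hasLongExtension_cons_of_forall_lt h]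

/-- The letter `x = a i` bumps position `i` without changing the state, whence the factor `ℓ`. -/
theorem acceptCount_succ {k : ℕ} {a : Fin ℓ → ℕ} (ha : StrictMono a) (hak : ∀ i, a i < k) (n : ℕ) :
    acceptCount k (n + 1) a = ℓ * acceptCount k n a +
      ∑ i, ∑ x ∈ range (a i), if ∀ j < i, a j < x then acceptCount k n (update a i x) else 0 := by
  have key : ∀ i, ∑ x ∈ range k, (if IsBumped a x i then acceptCount k n (update a i x) else 0) =
      acceptCount k n a +
      ∑ x ∈ range (a i), if ∀ j < i, a j < x then acceptCount k n (update a i x) else 0 := by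
    intro i
    rw [← Finset.sum_subset (range_subset_range.2 (hak i)) fun x _ hx =>
      if_neg fun h => hx (mem_range.2 (Nat.lt_succ_of_le h.1)), sum_range_succ, add_comm]
    congr 1
    · rw [if_pos ⟨le_rfl, fun j hj => ha hj⟩, update_eq_self]
    · refine sum_congr rfl fun x hx => if_congr ?_ rfl rfl
      exact and_iff_right (mem_range.1 hx).le
  rw [acceptCount_succ_eq_sum_letters]
  simp_rw [card_words_with_first_letter ha]
  rw [Fin.sum_univ_eq_sum_range
    (fun x => ∑ i, if IsBumped a x i then acceptCount k n (update a i x) else 0) k, sum_comm]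
  simp_rw [key]
  simp [sum_add_distrib]

/-- The number of sequences of `m` state-changing moves from the state `a`. -/
def descentCount : ℕ → (Fin ℓ → ℕ) → ℕ
  | 0, _ => 1
  | m + 1, a => ∑ i, ∑ x ∈ range (a i),
      if ∀ j < i, a j < x then descentCount m (update a i x) else 0

/-- Choose the `m` times of the moves; each other time has `ℓ` letters. The induction is Pascal's
rule, and the quotient of powers avoids truncated subtraction. -/
theorem acceptCount_eq_sum_descentCount (hℓ : 1 ≤ ℓ) {k : ℕ} (n : ℕ) {a : Fin ℓ → ℕ}
    (ha : StrictMono a) (hak : ∀ i, a i < k) :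
    (acceptCount k n a : ℝ) =
      ∑ m ∈ range (n + 1), descentCount m a * (n.choose m * ((ℓ : ℝ) ^ n / (ℓ : ℝ) ^ m)) := by
  have hℓ0 : (ℓ : ℝ) ≠ 0 := by positivity
  induction n generalizing a with
  | zero => simp [acceptCount_zero, descentCount]
  | succ n ih =>
    have hstep : (∑ i, ∑ x ∈ range (a i),
        ((if ∀ j < i, a j < x then acceptCount k n (update a i x) else 0 : ℕ) : ℝ)) =
        ∑ m ∈ range (n + 1), descentCount (m + 1) a *
          (n.choose m * ((ℓ : ℝ) ^ n / (ℓ : ℝ) ^ m)) := by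
      simp only [descentCount, Nat.cast_sum, sum_mul]
      rw [sum_comm]
      refine sum_congr rfl fun i _ => ?_
      rw [sum_comm]
      refine sum_congr rfl fun x hx => ?_
      split_ifs with h
      · have hi : IsBumped a x i := ⟨(mem_range.1 hx).le, h⟩
        exact ih (hi.strictMono_update ha) fun j => (hi.update_le j).trans_lt (hak j)
      · simp
    rw [acceptCount_succ ha hak]
    push_cast at hstep ⊢
    rw [hstep, ih ha hak, sum_range_succ' _ (n + 1)]
    have hlast : ∑ m ∈ range (n + 1),
        (descentCount m a : ℝ) * (n.choose m * ((ℓ : ℝ) ^ n / (ℓ : ℝ) ^ m)) =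
        ∑ m ∈ range (n + 1), (descentCount (m + 1) a : ℝ) *
          (n.choose (m + 1) * ((ℓ : ℝ) ^ n / (ℓ : ℝ) ^ (m + 1))) +
        descentCount 0 a * (n.choose 0 * ((ℓ : ℝ) ^ n / (ℓ : ℝ) ^ 0)) := by
      rw [← sum_range_succ' (fun m => (descentCount m a : ℝ) *
        (n.choose m * ((ℓ : ℝ) ^ n / (ℓ : ℝ) ^ m))) (n + 1), sum_range_succ _ (n + 1)]
      simp
    rw [hlast, mul_add, mul_sum, add_right_comm, ← sum_add_distrib]
    congr 1
    · refine sum_congr rfl fun m _ => ?_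
      rw [Nat.choose_succ_succ]
      push_cast
      field_simp
      ring
    · simp
      ring

theorem val_le_of_strictMono {a : Fin ℓ → ℕ} (ha : StrictMono a) (i : Fin ℓ) : (i : ℕ) ≤ a i := by
  rw [← Fin.card_Iio i, ← card_range (a i)]
  refine card_le_card_of_injOn a (fun j hj => ?_) ha.injective.injOn
  simpa using ha (by simpa using hj)

theorem sum_val_le_sum {a : Fin ℓ → ℕ} (ha : StrictMono a) : ∑ i : Fin ℓ, (i : ℕ) ≤ ∑ i, a i :=
  sum_le_sum fun i _ => val_le_of_strictMono ha i

theorem sum_update_add (a : Fin ℓ → ℕ) (i : Fin ℓ) (x : ℕ) :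
    ∑ j, update a i x j + a i = ∑ j, a j + x := by
  rw [sum_update_of_mem (mem_univ i), ← add_sum_erase univ a (mem_univ i),
    sdiff_singleton_eq_erase]
  ring

/-- Each move lowers the sum by at least one and keeps the state strictly increasing, so the sum
never falls below `0 + 1 + ⋯ + (ℓ - 1)`. -/
theorem descentCount_eq_zero {m : ℕ} {a : Fin ℓ → ℕ} (ha : StrictMono a)
    (h : ∑ i, a i < m + ∑ i : Fin ℓ, (i : ℕ)) : descentCount m a = 0 := by
  induction m generalizing a with
  | zero => exact absurd (sum_val_le_sum ha) (by omega)
  | succ m ih =>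
    refine sum_eq_zero fun i _ => sum_eq_zero fun x hx => ?_
    split_ifs with hx'
    · have hi : IsBumped a x i := ⟨(mem_range.1 hx).le, hx'⟩
      refine ih (hi.strictMono_update ha) ?_
      have := sum_update_add a i x
      have := mem_range.1 hx
      omega
    · rfl

end Automaton

/-! ### Counting the longest descents -/

section Determinant

variable {ℓ : ℕ}

/-- The determinant of the matrix of falling factorials of the entries of `a`. -/
def fallingDet (a : Fin ℓ → ℕ) : ℤ :=
  (Matrix.of fun j i : Fin ℓ => ((a i).descFactorial j : ℤ)).det

theorem fallingDet_eq_zero {a : Fin ℓ → ℕ} {i j : Fin ℓ} (hij : i ≠ j) (h : a i = a j) :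
    fallingDet a = 0 :=
  Matrix.det_zero_of_column_eq hij fun r => by simp [h]

theorem mul_descFactorial_pred (a j : ℕ) :
    (a : ℤ) * ((a - 1).descFactorial j : ℤ) = (a.descFactorial j : ℤ) * ((a : ℤ) - j) := by
  rcases a with _ | a
  · rcases j with _ | j <;> simp
  · have h : (a + 1) * a.descFactorial j = (a + 1 - j) * (a + 1).descFactorial j := by
      rw [← Nat.succ_descFactorial_succ, Nat.descFactorial_succ]
    rcases le_or_gt j (a + 1) with hj | hj
    · have h' := congrArg (Nat.cast : ℕ → ℤ) h
      rw [Nat.cast_mul, Nat.cast_mul, Nat.cast_sub hj] at h'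
      rw [Nat.add_sub_cancel, h', mul_comm]
    · simp [Nat.descFactorial_of_lt hj, Nat.descFactorial_of_lt (show a < j by omega)]

/-- In the Leibniz expansion the `σ` term acquires the factor `∑ i, (a i - σ i)`, which does not
depend on `σ`. -/
theorem sum_mul_fallingDet_update (a : Fin ℓ → ℕ) :
    ∑ i, (a i : ℤ) * fallingDet (update a i (a i - 1)) =
      (∑ i, (a i : ℤ) - ∑ i : Fin ℓ, (i : ℤ)) * fallingDet a := by
  have hterm : ∀ (σ : Equiv.Perm (Fin ℓ)) (i : Fin ℓ),
      (a i : ℤ) * ∏ j, (((update a i (a i - 1)) j).descFactorial (σ j) : ℤ) =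
        (∏ j, ((a j).descFactorial (σ j) : ℤ)) * ((a i : ℤ) - (σ i : ℕ)) := by
    intro σ i
    rw [← mul_prod_erase univ _ (mem_univ i), ← mul_prod_erase univ _ (mem_univ i), update_self,
      ← mul_assoc, mul_descFactorial_pred, mul_right_comm]
    congr 2
    exact prod_congr rfl fun j hj => by rw [update_of_ne (ne_of_mem_erase hj)]
  simp only [fallingDet, Matrix.det_apply', Matrix.of_apply, mul_sum]
  rw [sum_comm]
  refine sum_congr rfl fun σ _ => ?_
  simp_rw [mul_left_comm (a _ : ℤ), hterm, ← mul_sum, sum_sub_distrib]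
  rw [Equiv.sum_comp σ fun i => ((i : ℕ) : ℤ)]
  ring

/-- Falling factorials are monic polynomials of degree `j`, so this is a Vandermonde determinant,
which is translation invariant. -/
theorem fallingDet_add (c : ℕ) :
    fallingDet (fun i : Fin ℓ => c + (i : ℕ)) = ∏ i : Fin ℓ, ((i : ℕ).factorial : ℤ) := by
  have h := Matrix.det_eval_matrixOfPolynomials_eq_det_vandermonde
    (fun i : Fin ℓ => ((c + (i : ℕ) : ℕ) : ℤ)) (fun j => descPochhammer ℤ j)
    (fun j => descPochhammer_natDegree ℤ j) (fun j => monic_descPochhammer ℤ j)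
  simp only [descPochhammer_eval_eq_descFactorial] at h
  rw [fallingDet, ← Matrix.det_transpose]
  refine Eq.trans h.symm ?_
  have h2 : (fun i : Fin ℓ => ((c + (i : ℕ) : ℕ) : ℤ)) =
      fun i : Fin ℓ => ((i : ℕ) : ℤ) + c := by
    ext i
    push_cast
    ring
  rw [h2, Matrix.det_vandermonde_add]
  rcases ℓ with _ | n
  · simp
  · rw [Matrix.det_vandermonde_id_eq_superFactorial]
    clear h h2
    induction n with
    | zero => simp
    | succ n ih =>
      rw [Fin.prod_univ_castSucc, Nat.superFactorial_succ]
      push_cast at ih ⊢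
      rw [ih, mul_comm]
      simp

/-- With no slack in the sum, a drop of two or more leaves too little for the remaining `m` moves.
-/
theorem descentCount_succ_of_sum_eq {m : ℕ} {a : Fin ℓ → ℕ} (ha : StrictMono a)
    (h : ∑ i, a i = m + 1 + ∑ i : Fin ℓ, (i : ℕ)) :
    descentCount (m + 1) a = ∑ i, if 0 < a i ∧ ∀ j < i, a j < a i - 1 then
      descentCount m (update a i (a i - 1)) else 0 := by
  refine sum_congr rfl fun i _ => ?_
  by_cases hi : 0 < a i
  · rw [sum_eq_single (a i - 1)]
    · simp [hi]
    · intro x hx hne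
      split_ifs with hx'
      · have hi' : IsBumped a x i := ⟨(mem_range.1 hx).le, hx'⟩
        refine descentCount_eq_zero (hi'.strictMono_update ha) ?_
        have := sum_update_add a i x
        have := mem_range.1 hx
        omega
      · rfl
    · intro hn
      exact absurd (mem_range.2 (by omega)) hn
  · have : a i = 0 := by omega
    simp [this]

/-- Frobenius' formula for standard Young tableaux of shape `a i - i`: both sides satisfy the same
recursion. -/
theorem descentCount_mul_prod_factorial {m : ℕ} {a : Fin ℓ → ℕ} (ha : StrictMono a)
    (h : ∑ i, a i = m + ∑ i : Fin ℓ, (i : ℕ)) :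
    (descentCount m a : ℤ) * ∏ i, ((a i).factorial : ℤ) = m.factorial * fallingDet a := by
  induction m generalizing a with
  | zero =>
    have hle : ∀ i ∈ (univ : Finset (Fin ℓ)), (i : ℕ) ≤ a i := fun i _ =>
      val_le_of_strictMono ha i
    have heq : a = fun i : Fin ℓ => 0 + (i : ℕ) := by
      ext i
      rw [zero_add]
      exact ((sum_eq_sum_iff_of_le hle).1 (by omega) i (mem_univ i)).symm
    rw [heq, fallingDet_add]
    simp [descentCount]
  | succ m ih =>
    have hterm : ∀ i, ((if 0 < a i ∧ ∀ j < i, a j < a i - 1 then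
        descentCount m (update a i (a i - 1)) else 0 : ℕ) : ℤ) * ∏ i, ((a i).factorial : ℤ) =
        m.factorial * ((a i : ℤ) * fallingDet (update a i (a i - 1))) := by
      intro i
      by_cases hi : 0 < a i
      · by_cases hv : ∀ j < i, a j < a i - 1
        · rw [if_pos ⟨hi, hv⟩]
          have hi' : IsBumped a (a i - 1) i := ⟨Nat.sub_le _ _, hv⟩
          have hsum := sum_update_add a i (a i - 1)
          have herase : ∏ j ∈ univ.erase i, ((update a i (a i - 1) j).factorial : ℤ) =
              ∏ j ∈ univ.erase i, ((a j).factorial : ℤ) :=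
            prod_congr rfl fun j hj => by rw [update_of_ne (ne_of_mem_erase hj)]
          rw [mul_left_comm, ← ih (hi'.strictMono_update ha) (by omega),
            ← mul_prod_erase univ _ (mem_univ i), ← mul_prod_erase univ _ (mem_univ i),
            update_self, ← Nat.mul_factorial_pred hi.ne', herase]
          push_cast
          ring
        -- A forbidden unit step makes two columns equal, so it may be included in the sum over all
        -- `i`.
        · rw [if_neg fun h => hv h.2]
          push Not at hv
          obtain ⟨j, hj, hij⟩ := hv
          rw [fallingDet_eq_zero hj.ne]
          · simp
          · rw [update_self, update_of_ne hj.ne]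
            have := ha hj
            omega
      · have : a i = 0 := by omega
        simp [this]
    rw [descentCount_succ_of_sum_eq ha h]
    push_cast at hterm ⊢
    rw [sum_mul, sum_congr rfl fun i _ => hterm i, ← mul_sum, sum_mul_fallingDet_update]
    have h' := congrArg (Nat.cast : ℕ → ℤ) h
    push_cast at h'
    rw [h', Nat.factorial_succ]
    push_cast
    ring

end Determinant

/-! ### Words avoiding the increasing pattern -/

theorem contains_increasingPattern_iff {ℓ k n : ℕ} (w : Fin n → Fin k) :
    Contains w (increasingPattern ℓ) ↔
      ∃ t : Fin (ℓ + 1) → Fin n, StrictMono t ∧ StrictMono (w ∘ t) := by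
  refine exists_congr fun t => and_congr_right fun _ => ⟨fun h => ?_, fun h i j => ?_⟩
  · intro i j hij
    have := (h j i).not
    simp only [increasingPattern] at this
    simpa using this.2 (by simpa using hij)
  · simpa [increasingPattern] using h.le_iff_le (a := i) (b := j)

theorem contains_increasingPattern_iff_exists_sublist {ℓ k n : ℕ} (w : Fin n → Fin k) :
    Contains w (increasingPattern ℓ) ↔
      ∃ s : List ℕ, s.Sublist (List.ofFn fun i => (w i : ℕ)) ∧ s.Pairwise (· < ·) ∧
        ℓ < s.length := by
  rw [contains_increasingPattern_iff]
  constructor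
  · rintro ⟨t, ht, hwt⟩
    refine ⟨List.ofFn fun i => (w (t i) : ℕ), ?_, ?_, by simp⟩
    · rw [List.sublist_iff_exists_fin_orderEmbedding_get_eq]
      refine ⟨(Fin.castOrderIso (by simp)).toOrderEmbedding.trans
        ((OrderEmbedding.ofStrictMono t ht).trans
          (Fin.castOrderIso (by simp)).toOrderEmbedding), fun i => ?_⟩
      rw [List.get_ofFn, List.get_ofFn]
      rfl
    · rw [List.pairwise_ofFn]
      exact fun i j hij => hwt hij
  · rintro ⟨s, hs, hp, hlen⟩
    obtain ⟨f, hf⟩ := List.sublist_iff_exists_fin_orderEmbedding_get_eq.1 hs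
    have hlen' : (List.ofFn fun i => (w i : ℕ)).length = n := by simp
    have hval : ∀ i, (w (Fin.cast hlen' (f i)) : ℕ) = s.get i := fun i => by
      rw [hf i, List.get_ofFn]
    refine ⟨fun i => Fin.cast hlen' (f (Fin.castLE hlen i)), fun i j hij => ?_, fun i j hij => ?_⟩
    · exact f.strictMono (show Fin.castLE hlen i < Fin.castLE hlen j from hij)
    · rw [Fin.lt_def]
      simp only [comp_apply, hval]
      exact List.pairwise_iff_get.1 hp _ _ hij

theorem length_le_of_pairwise_lt {k : ℕ} {s : List ℕ} (hs : s.Pairwise (· < ·)) {y : ℕ}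
    (hlow : ∀ z ∈ s, y < z) (hhigh : ∀ z ∈ s, z < k) : s.length ≤ k - (y + 1) := by
  have hnd : s.Nodup := hs.imp fun h => h.ne
  rw [← List.toFinset_card_of_nodup hnd, ← Nat.card_Ico]
  exact card_le_card fun z hz => by
    have := hlow z (by simpa using hz)
    have := hhigh z (by simpa using hz)
    exact mem_Ico.2 ⟨by omega, by omega⟩

/-- If some initial entry lies below `y`, there are at most `y - (k - ℓ)` of them, and at most `k -
y` letters from `y` on: at most `ℓ` in total. So a long extension uses no initial entry. -/
theorem hasLongExtension_initial_iff {ℓ k : ℕ} (hk : ℓ ≤ k) {u : List ℕ} (hu : ∀ x ∈ u, x < k) :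
    HasLongExtension (fun i : Fin ℓ => k - ℓ + (i : ℕ)) u ↔
      ∃ s : List ℕ, s.Sublist u ∧ s.Pairwise (· < ·) ∧ ℓ < s.length := by
  constructor
  · rintro ⟨y, s, hsub, hs, hlen⟩
    refine ⟨y :: s, hsub, hs, ?_⟩
    have hs' := List.pairwise_cons.1 hs
    have hyk : y < k := hu y (hsub.subset (by simp))
    have hlen' := length_le_of_pairwise_lt (k := k) hs'.2 hs'.1
      fun z hz => hu z (hsub.subset (by simp [hz]))
    have hcard : #{i : Fin ℓ | k - ℓ + (i : ℕ) < y} ≤ y - (k - ℓ) := by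
      rw [← card_range (y - (k - ℓ))]
      refine card_le_card_of_injOn (fun i : Fin ℓ => (i : ℕ)) (fun i hi => ?_)
        Fin.val_injective.injOn
      simp only [coe_filter, mem_univ, true_and, Set.mem_ofPred_eq] at hi
      simp only [coe_range, Set.mem_Iio]
      omega
    simp only [List.length_cons] at hlen ⊢
    omega
  · rintro ⟨s, hsub, hs, hlen⟩
    rcases s with _ | ⟨y, s⟩
    · simp at hlen
    · exact ⟨y, s, hsub, hs, by omega⟩

theorem ncard_avoidingWords_eq_acceptCount {ℓ k : ℕ} (hk : ℓ ≤ k) (n : ℕ) :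
    (avoidingWords k n (increasingPattern ℓ)).ncard =
      acceptCount k n (fun i : Fin ℓ => k - ℓ + (i : ℕ)) := by
  rw [acceptCount, ← Nat.card_coe_set_eq]
  refine Nat.card_congr (Equiv.subtypeEquivRight fun w => not_congr ?_)
  rw [hasLongExtension_initial_iff hk (by simp [List.mem_ofFn]),
    contains_increasingPattern_iff_exists_sublist]

/-! ### Asymptotics -/

open Filter Topology

theorem tendsto_choose_div_pow (m : ℕ) :
    Tendsto (fun n : ℕ => (n.choose m : ℝ) / (n : ℝ) ^ m) atTop (𝓝 (m.factorial : ℝ)⁻¹) := by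
  have hne : ∀ᶠ n : ℕ in atTop, (n : ℝ) ^ m / m.factorial ≠ 0 := by
    filter_upwards [eventually_gt_atTop 0] with n hn
    positivity
  have h := ((Asymptotics.isEquivalent_iff_tendsto_one hne).1
    (isEquivalent_choose m)).mul_const (m.factorial : ℝ)⁻¹
  rw [one_mul] at h
  refine h.congr' ?_
  filter_upwards [eventually_gt_atTop 0] with n hn
  have : (m.factorial : ℝ) ≠ 0 := by positivity
  simp only [Pi.div_apply]
  field_simp

theorem tendsto_choose_div_pow_of_lt {m N : ℕ} (h : m < N) :
    Tendsto (fun n : ℕ => (n.choose m : ℝ) / (n : ℝ) ^ N) atTop (𝓝 0) := by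
  have h1 : Tendsto (fun n : ℕ => ((n : ℝ) ^ (N - m))⁻¹) atTop (𝓝 0) :=
    ((tendsto_pow_atTop (Nat.sub_pos_of_lt h).ne').comp
      tendsto_natCast_atTop_atTop).inv_tendsto_atTop
  have h2 := (tendsto_choose_div_pow m).mul h1
  rw [mul_zero] at h2
  refine h2.congr fun n => ?_
  rw [← div_eq_mul_inv, div_div, ← pow_add, Nat.add_sub_cancel' h.le]

theorem prod_Icc_add_sub_one_mul_factorial (i d : ℕ) :
    (∏ j ∈ Icc 1 d, (((i + 1 : ℕ) : ℝ) + (j : ℝ) - 1)) * (i.factorial : ℝ) =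
      ((d + i).factorial : ℝ) := by
  induction d with
  | zero => simp
  | succ d ih =>
    rw [prod_Icc_succ_top (Nat.le_add_left 1 d), mul_right_comm, ih, Nat.succ_add,
      Nat.factorial_succ]
    push_cast
    ring

theorem prod_prod_Icc_mul_prod_factorial (ℓ d : ℕ) :
    (∏ i ∈ Icc 1 ℓ, ∏ j ∈ Icc 1 d, ((i : ℝ) + (j : ℝ) - 1)) *
      ∏ i : Fin ℓ, ((i : ℕ).factorial : ℝ) = ∏ i : Fin ℓ, ((d + (i : ℕ)).factorial : ℝ) := by
  induction ℓ with
  | zero => simp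
  | succ ℓ ih =>
    rw [prod_Icc_succ_top (Nat.le_add_left 1 ℓ), Fin.prod_univ_castSucc, Fin.prod_univ_castSucc,
      mul_mul_mul_comm]
    simp only [Fin.val_castSucc, Fin.val_last]
    rw [ih, prod_Icc_add_sub_one_mul_factorial]

/-- The hook length formula for the `ℓ × d` rectangle. -/
theorem descentCount_initial (ℓ d : ℕ) :
    (descentCount (ℓ * d) (fun i : Fin ℓ => d + (i : ℕ)) : ℝ) *
      ∏ i ∈ Icc 1 ℓ, ∏ j ∈ Icc 1 d, ((i : ℝ) + (j : ℝ) - 1) = (ℓ * d).factorial := by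
  have hmono : StrictMono fun i : Fin ℓ => d + (i : ℕ) := fun i j h => by
    simpa using h
  have h := descentCount_mul_prod_factorial hmono (m := ℓ * d) (by simp [sum_add_distrib])
  rw [fallingDet_add] at h
  have h' := congrArg (Int.cast : ℤ → ℝ) h
  push_cast at h'
  rw [← prod_prod_Icc_mul_prod_factorial, ← mul_assoc] at h'
  exact mul_right_cancel₀ (prod_ne_zero_iff.2 fun i _ => by positivity) h'

theorem tendsto_acceptCount_div {ℓ k : ℕ} (hℓ : 1 ≤ ℓ) {a : Fin ℓ → ℕ} (ha : StrictMono a)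
    (hak : ∀ i, a i < k) {N : ℕ} (hN : ∑ i, a i = N + ∑ i : Fin ℓ, (i : ℕ)) :
    Tendsto (fun n : ℕ => (acceptCount k n a : ℝ) / ((n : ℝ) ^ N * (ℓ : ℝ) ^ n)) atTop
      (𝓝 (descentCount N a * (N.factorial : ℝ)⁻¹ / (ℓ : ℝ) ^ N)) := by
  have hℓ0 : (ℓ : ℝ) ≠ 0 := by positivity
  have hlim : Tendsto (fun n : ℕ => ∑ m ∈ range (N + 1),
      (descentCount m a : ℝ) * ((n.choose m : ℝ) / (n : ℝ) ^ N) / (ℓ : ℝ) ^ m) atTop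
      (𝓝 (∑ m ∈ range N, (descentCount m a : ℝ) * 0 / (ℓ : ℝ) ^ m +
        descentCount N a * (N.factorial : ℝ)⁻¹ / (ℓ : ℝ) ^ N)) := by
    simp_rw [sum_range_succ _ N]
    refine (tendsto_finsetSum _ fun m hm => ?_).add ?_
    · exact ((tendsto_choose_div_pow_of_lt (mem_range.1 hm)).const_mul _).div_const _
    · exact ((tendsto_choose_div_pow N).const_mul _).div_const _
  simp only [mul_zero, zero_div, sum_const_zero, zero_add] at hlim
  refine hlim.congr' ?_
  -- Once `n ≥ N`, the exact sum contains every `m ≤ N`; its terms with `m > N` vanish.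
  filter_upwards [eventually_ge_atTop N] with n hn
  rw [acceptCount_eq_sum_descentCount hℓ n ha hak,
    ← sum_subset (range_subset_range.2 (Nat.succ_le_succ hn)) fun m _ hm => ?_, sum_div]
  · refine sum_congr rfl fun m _ => ?_
    field_simp
  · rw [descentCount_eq_zero ha, Nat.cast_zero, zero_mul]
    rw [mem_range, not_lt] at hm
    omega

end PatternAvoidance

theorem mainTheorem2 (ℓ k : ℕ) (hℓ : 1 ≤ ℓ) (hk : ℓ ≤ k) :
    PatternAvoidance.AsympEq
      (fun n : ℕ =>
        ((PatternAvoidance.avoidingWords k n (PatternAvoidance.increasingPattern ℓ)).ncard : ℝ))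
      (fun n : ℕ =>
        PatternAvoidance.regevConstant ℓ k * (n : ℝ) ^ (ℓ * (k - ℓ)) * (ℓ : ℝ) ^ n) := by
  have hmono : StrictMono fun i : Fin ℓ => k - ℓ + (i : ℕ) := fun i j h => by
    simpa using h
  have hlim := (PatternAvoidance.tendsto_acceptCount_div hℓ hmono (k := k) (fun i => by omega)
    (N := ℓ * (k - ℓ)) (by simp [Finset.sum_add_distrib])).div_const
    (PatternAvoidance.regevConstant ℓ k)
  have hdesc := PatternAvoidance.descentCount_initial ℓ (k - ℓ)
  have hfac : ((ℓ * (k - ℓ)).factorial : ℝ) ≠ 0 := by positivity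
  have hℓ0 : (ℓ : ℝ) ^ (ℓ * (k - ℓ)) ≠ 0 := by positivity
  have hone : (PatternAvoidance.descentCount (ℓ * (k - ℓ)) fun i : Fin ℓ => k - ℓ + (i : ℕ)) *
      ((ℓ * (k - ℓ)).factorial : ℝ)⁻¹ / (ℓ : ℝ) ^ (ℓ * (k - ℓ)) /
      PatternAvoidance.regevConstant ℓ k = 1 := by
    rw [PatternAvoidance.regevConstant, div_inv_eq_mul, ← mul_assoc, div_mul_cancel₀ _ hℓ0,
      mul_right_comm, hdesc, mul_inv_cancel₀ hfac]
  rw [hone] at hlim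
  refine hlim.congr fun n => ?_
  dsimp only
  rw [PatternAvoidance.ncard_avoidingWords_eq_acceptCount hk, div_div,
    mul_comm _ (PatternAvoidance.regevConstant ℓ k), ← mul_assoc]
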